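/- Let $p$ be a prime, $s,m\ge 1$, and let $n_1,\dots,n_s\ge 0$ be integers with $n_s\ge 1$. Let $H$ be an $m\times(n_1+2n_2+\dots+sn_s)$ matrix of rank $m$ over $\mathbb F_p$, whose columns are divided into $n=n_1+\dots+n_s$ blocks, $n_i$ of them of size $i$; let $H_{i,j}\subseteq\mathbb F_p^m$ be the span of the columns in the $j$th block of size $i$. Let $C\subseteq V=(\mathbb F_p^1)^{n_1}\times\dots\times(\mathbb F_p^s)^{n_s}$ be the null space of $H$, regarded as a set of $n$-tuples, and let $C^\perp$ be the code generated by the rows of $H$. Put $$k=\sum_{i=1}^s n_i(p^s-p^{s-i}),\qquad \mu=\frac{k}{p^m-1},\qquad \nu=n-p^{m-s}\mu .$$ Definitions. - A nonempty multiset $D$ of tuples from $V$ is an orthogonal array of strength $t$, $0\le t\le n$, if for any $t$ distinct positions and any prescribed values in them, the number of tuples of $D$ with these values is $|D|$ divided by the product of the sizes of the $t$ alphabets. It attains the mixed-level Bierbrauer–Friedman bound if $|D|=|V|\bigl(1-(1-\frac1q)\frac n{t+1}\bigr)$, where $q$ is the harmonic mean of the $n$ alphabet sizes, i.e. $\frac1q=\frac1n\sum_{i=1}^s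 n_ip^{-i}$. - The mixed-level Hamming multigraph on $V$ joins two tuples that differ in exactly one position, with alphabet $\mathbb F_p^i$, by an edge of multiplicity $p^{s-i}$ and has no other edges. A set $D$ of vertices of a regular multigraph is a $\{b;c\}$-CR code, $b,c>0$, if every vertex of $D$ is joined by exactly $b$ edges to the complement of $D$ and every vertex outside $D$ by exactly $c$ edges to $D$. - An additive code is one-weight of weight $w$ if each of its nonzero codewords has exactly $w$ nonzero blocks; it is alphabet-effective if in each block of size $i$ every element of $\mathbb F_p^i$ occurs in some codeword. - A multiset of subspaces of a vector space is a $\lambda$-fold partition if every nonzero vector belongs to exactly $\lambda$ of them, counted with multiplicity. Then the following assertions are equivalent: (i) for some integer $t$ with $0\le t\le n$, $C$ is an orthogonal array of strength $t$ attaining the mixed-level Bierbrauer–Friedman bound; (i') $t=\frac{\mu+k}{p^s}-1$ is an integer with $0\le t\le n$ and $C$ is an orthogonal array of strength $t$; (ii) $C$ is a $\{k;\mu\}$-CR code in the mixed-level Hamming multigraph; (iii) $C^\perp$ is an alphabet-effective one-weight code of weight $\mu p^{m-s}$; (iv) the multiset in which each $H_{i,j}$ is taken $p^{s-i}$ times ($1\le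 i\le s$, $1\le j\le n_i$) is a $\mu$-fold partition of $\mathbb F_p^m$; (v) the multiset of the subspaces $H_{i,j}^\perp$ (orthogonal complements in $\mathbb F_p^m$ with respect to the standard dot product; $1\le i\le s$, $1\le j\le n_i$) is a $\nu$-fold partition of $\mathbb F_p^m$. -/

import Mathlib

noncomputable section

/-! ### Multigraphs, completely regular codes of covering radius one, and orthogonal arrays -/

/-- A multigraph (multiple edges and loops allowed), given by its adjacency matrix:
`mult x y` is the multiplicity of the edge `{x, y}`. -/
structure EdgeMultigraph (V : Type*) where
  mult : V → V → ℕ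
  symm : ∀ x y, mult x y = mult y x

namespace EdgeMultigraph

variable {V : Type*} [Fintype V]

/-- All vertices have the same degree. -/
def IsRegular (G : EdgeMultigraph V) : Prop :=
  ∃ d : ℕ, ∀ x, ∑ y, G.mult x y = d

open scoped Classical in
/-- The number of edges, counted with multiplicity, between the vertex `x` and the set `S`
(used for `x ∉ S` only). -/
def edgesTo (G : EdgeMultigraph V) (x : V) (S : Set V) : ℕ :=
  ∑ y ∈ Finset.univ.filter (fun y => y ∈ S), G.mult x y

/-- `C` is a `{b; c}`-CR code of the regular multigraph `G`. The parameters are taken in `ℚ` so that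
a possibly fractional number can be substituted; then the condition simply fails. -/
def IsCRCode (G : EdgeMultigraph V) (C : Set V) (b c : ℚ) : Prop :=
  G.IsRegular ∧ 0 < b ∧ 0 < c ∧
    (∀ x ∈ C, (G.edgesTo x Cᶜ : ℚ) = b) ∧
    (∀ x ∉ C, (G.edgesTo x C : ℚ) = c)

end EdgeMultigraph

section MixedLevel

variable {ι : Type*} [Fintype ι] (A : ι → Type*) [∀ i, Fintype (A i)]

open scoped Classical in
/-- The mixed-level Hamming multigraph on `∏ i, A i`: with `q i = |A i|` and `Q = lcm (q i)`, two
tuples that differ in the `i`th position only are joined by an edge of multiplicity `Q / q i`,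
other pairs are not joined. -/
def hammingMultigraph : EdgeMultigraph (∀ i, A i) where
  mult x y := ∑ i, if x i ≠ y i ∧ ∀ j, j ≠ i → x j = y j then
    (Finset.univ.lcm fun j => Fintype.card (A j)) / Fintype.card (A i) else 0
  symm x y := by simp only [ne_comm, eq_comm]

variable {A}

open scoped Classical in
/-- The multiset `C` of tuples is an orthogonal array of strength `t` (with `t ≤ n`, where `n` is
the number of positions): for all choices of `t` positions and of values in these positions, the
number of tuples in `C` with these values is `|C|` over the product of the sizes of the `t`
alphabets. -/
def IsOrthogonalArray (C : Multiset (∀ i, A i)) (t : ℕ) : Prop :=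
  C ≠ 0 ∧ t ≤ Fintype.card ι ∧
    ∀ T : Finset ι, T.card = t → ∀ a : ∀ i : T, A i,
      ((C.countP fun x => ∀ i : T, x i = a i : ℕ) : ℚ) =
        (C.card : ℚ) / ∏ i ∈ T, (Fintype.card (A i) : ℚ)

variable (A)

/-- The harmonic mean `q` of the alphabet sizes: `1 / q = (1 / n) * ∑ i, 1 / q i`. -/
def harmonicMeanLevel : ℚ :=
  ((1 / (Fintype.card ι : ℚ)) * ∑ i, 1 / (Fintype.card (A i) : ℚ))⁻¹

/-- The mixed-level Bierbrauer--Friedman bound `q₁ ⋯ qₙ (1 - (1 - 1/q) n / (t + 1))`. -/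
def bierbrauerFriedmanBound (t : ℕ) : ℚ :=
  (∏ i, (Fintype.card (A i) : ℚ)) *
    (1 - (1 - 1 / harmonicMeanLevel A) * ((Fintype.card ι : ℚ) / ((t : ℚ) + 1)))

end MixedLevel

/-! ### Multifold partitions -/

open scoped Classical in
/-- Every nonzero vector belongs to exactly `μ` members of the multiset `D` of subspaces, counted
with multiplicity. -/
def IsFoldPartition {F S : Type*} [Field F] [AddCommGroup S] [Module F S]
    (D : Multiset (Submodule F S)) (μ : ℚ) : Prop :=
  ∀ v : S, v ≠ 0 → ((D.countP fun W => v ∈ W : ℕ) : ℚ) = μ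

/-- The dual subspace with respect to the standard dot product. -/
def dotDual {F : Type*} [Field F] {m : ℕ} (W : Submodule F (Fin m → F)) :
    Submodule F (Fin m → F) where
  carrier := {u | ∀ w ∈ W, u ⬝ᵥ w = 0}
  add_mem' := by
    intro u v hu hv w hw
    rw [add_dotProduct, hu w hw, hv w hw, add_zero]
  zero_mem' := by
    intro w _
    exact zero_dotProduct w
  smul_mem' := by
    intro c u hu w hw
    rw [smul_dotProduct, hu w hw, smul_zero]

/-! ### Additive codes with mixed block sizes -/

/-- The blocks: `⟨i, j⟩` is the `j`th block of size `i`, for `1 ≤ i ≤ s` and `j < n i`. -/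
abbrev Block (s : ℕ) (n : ℕ → ℕ) : Type := Σ i : Finset.Icc 1 s, Fin (n i)

/-- The size of a block. -/
abbrev Block.size {s : ℕ} {n : ℕ → ℕ} (b : Block s n) : ℕ := b.1

/-- The `n 1 + 2 * n 2 + ⋯ + s * n s` columns of a check matrix, divided into blocks. -/
abbrev BlockColumn (s : ℕ) (n : ℕ → ℕ) : Type := Σ b : Block s n, Fin b.size

/-- The alphabet `𝔽_p ^ i` at a block of size `i`. -/
abbrev BlockAlphabet (p : ℕ) {s : ℕ} {n : ℕ → ℕ} (b : Block s n) : Type := Fin b.size → ZMod p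

/-- The space `(𝔽_p ^ 1) ^ (n 1) × ⋯ × (𝔽_p ^ s) ^ (n s)`. -/
abbrev BlockSpace (p s : ℕ) (n : ℕ → ℕ) : Type := ∀ b : Block s n, BlockAlphabet p b

section Codes

variable {p s m : ℕ} {n : ℕ → ℕ}

/-- The additive code with check matrix `H`: its null space. -/
def nullCode (H : Matrix (Fin m) (BlockColumn s n) (ZMod p)) :
    Submodule (ZMod p) (BlockSpace p s n) where
  carrier := {v | H.mulVec (fun c => v c.1 c.2) = 0}
  add_mem' := by
    intro u v hu hv
    have h := Matrix.mulVec_add H (fun c => u c.1 c.2) (fun c => v c.1 c.2)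
    rw [Set.mem_ofPred_eq] at hu hv
    rw [hu, hv, add_zero] at h
    exact h
  zero_mem' := Matrix.mulVec_zero H
  smul_mem' := by
    intro a v hv
    have h := Matrix.mulVec_smul H a (fun c => v c.1 c.2)
    rw [Set.mem_ofPred_eq] at hv
    rw [hv, smul_zero] at h
    exact h

/-- The additive code generated by the rows of `H`. -/
def rowCode (H : Matrix (Fin m) (BlockColumn s n) (ZMod p)) :
    Submodule (ZMod p) (BlockSpace p s n) :=
  Submodule.span (ZMod p) (Set.range fun (r : Fin m) (b : Block s n) (l : Fin b.size) => H r ⟨b, l⟩)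

/-- The subspace of `𝔽_p ^ m` spanned by the columns in the block `b` of `H`. -/
def blockSpan (H : Matrix (Fin m) (BlockColumn s n) (ZMod p)) (b : Block s n) :
    Submodule (ZMod p) (Fin m → ZMod p) :=
  Submodule.span (ZMod p) (Set.range fun (l : Fin b.size) (r : Fin m) => H r ⟨b, l⟩)

/-- The number of nonzero blocks. -/
def blockWeight (c : BlockSpace p s n) : ℕ :=
  (Finset.univ.filter fun b => c b ≠ 0).card

/-- Every nonzero codeword has exactly `w` nonzero blocks. -/
def IsOneWeight (C : Submodule (ZMod p) (BlockSpace p s n)) (w : ℚ) : Prop :=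
  ∀ c ∈ C, c ≠ 0 → (blockWeight c : ℚ) = w

/-- In each block, every element of the alphabet occurs in some codeword. -/
def IsAlphabetEffective (C : Submodule (ZMod p) (BlockSpace p s n)) : Prop :=
  ∀ (b : Block s n) (a : BlockAlphabet p b), ∃ c ∈ C, c b = a

open scoped Classical in
/-- A code as a multiset of tuples, each of multiplicity one. -/
def codeMultiset [NeZero p] (C : Submodule (ZMod p) (BlockSpace p s n)) :
    Multiset (BlockSpace p s n) :=
  (Finset.univ.filter fun x => x ∈ C).val

/-- The multiset in which the span of each block of size `i` is taken `p ^ (s - i)` times. -/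
def blockMultiset (H : Matrix (Fin m) (BlockColumn s n) (ZMod p)) :
    Multiset (Submodule (ZMod p) (Fin m → ZMod p)) :=
  ∑ b : Block s n, Multiset.replicate (p ^ (s - b.size)) (blockSpan H b)

/-- The multiset of the duals of the spans of the blocks. -/
def dualBlockMultiset (H : Matrix (Fin m) (BlockColumn s n) (ZMod p)) [Fact p.Prime] :
    Multiset (Submodule (ZMod p) (Fin m → ZMod p)) :=
  (Finset.univ : Finset (Block s n)).val.map fun b => dotDual (blockSpan H b)

end Codes

end

/-! ### Duality for the standard dot product -/

section Duality

variable {F : Type*} [Field F] {m : ℕ}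

/-! Every condition is a statement about incidences between vectors of $\mathbb F_p^m$ and the block
spans or their duals.

For $u\in\mathbb F_p^m$ the row combination `rowWord H u` vanishes at block $b$ exactly when $u\in
H_b^\perp$. So its weight is $n$ minus the number of duals containing $u$, and (iii) and (v) count
complementary things. A null space has strength $t$ iff every nonzero dual codeword has weight above
$t$ (`isOrthogonalArray_nullCode`, `lt_blockWeight_of_isOrthogonalArray`). As $|C|=|V|/p^m$, the
bound is attained only for $t+1=\mu p^{m-s}$, the weight in (iii). Strength $t$ then says that each
$u\ne0$ lies in at most $\nu$ duals. But $\nu$ is the average number when all blocks have full rank,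
and a rank defect only enlarges duals, so equality holds everywhere
(`finrank_blockSpan_eq_size_of_sum_le`).

Conditions (iv) and (v) are Fourier duals (`dual_weighted_partition`). The transform of a function
constant off $0$ is constant off $0$, and it takes the indicator of $W$ to $|W|$ times that of
$W^\perp$.

For (ii), $k$ is the full degree of the multigraph, so no two codewords are adjacent, which means
that each block has independent columns. The edges from $x$ into $C$ then count the block spans
containing the syndrome of $x$, with the multiplicities of (iv). -/

lemma mem_dotDual {W : Submodule F (Fin m → F)} {u : Fin m → F} :
    u ∈ dotDual W ↔ ∀ w ∈ W, u ⬝ᵥ w = 0 := Iff.rfl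

lemma dotProductBilin_nondegenerate :
    (dotProductBilin F F : LinearMap.BilinForm F (Fin m → F)).Nondegenerate := by
  refine ⟨fun x hx => ?_, fun x hx => ?_⟩
  · exact dotProduct_eq_zero x fun y => hx y
  · exact dotProduct_eq_zero x fun y => by rw [dotProduct_comm]; exact hx y

lemma dotDual_eq_orthogonal (W : Submodule F (Fin m → F)) :
    dotDual W = LinearMap.BilinForm.orthogonal (dotProductBilin F F) W := by
  ext u
  rw [mem_dotDual, LinearMap.BilinForm.mem_orthogonal_iff]
  exact forall₂_congr fun w _ => by rw [dotProduct_comm]; rfl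

lemma dotDual_dotDual (W : Submodule F (Fin m → F)) : dotDual (dotDual W) = W := by
  rw [dotDual_eq_orthogonal, dotDual_eq_orthogonal]
  refine LinearMap.BilinForm.orthogonal_orthogonal dotProductBilin_nondegenerate ?_ W
  intro x y h
  exact (dotProduct_comm y x).trans h

lemma finrank_dotDual (W : Submodule F (Fin m → F)) :
    Module.finrank F (dotDual W) = m - Module.finrank F W := by
  rw [dotDual_eq_orthogonal, LinearMap.BilinForm.finrank_orthogonal dotProductBilin_nondegenerate,
    Module.finrank_fin_fun]

/-- The dual is zero, so the double dual is everything. This reduces surjectivity of a syndrome map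
to a property of dual codewords. -/
lemma eq_top_of_forall_dotProduct_eq_zero {W : Submodule F (Fin m → F)}
    (h : ∀ u : Fin m → F, (∀ w ∈ W, u ⬝ᵥ w = 0) → u = 0) : W = ⊤ := by
  rw [eq_top_iff, ← dotDual_dotDual W]
  intro x _ w hw
  rw [h w hw, dotProduct_zero]

end Duality

/-! ### Character sums and counting over subspaces of $\mathbb F_p^m$ -/

section Characters

variable {p m : ℕ} [Fact p.Prime]

open scoped Classical in
/-- The character sum over a subspace is concentrated on the dual subspace. -/
lemma sum_stdAddChar_dotProduct (W : Submodule (ZMod p) (Fin m → ZMod p)) (u : Fin m → ZMod p) :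
    ∑ w, (if w ∈ W then ZMod.stdAddChar (u ⬝ᵥ w) else 0 : ℂ) =
      if u ∈ dotDual W then (Nat.card W : ℂ) else 0 := by
  let f : W →+ ZMod p := ((dotProductBilin (ZMod p) (ZMod p) u).comp W.subtype).toAddMonoidHom
  have hf : ∀ w : W, f w = u ⬝ᵥ (w : Fin m → ZMod p) := fun w => rfl
  have key := AddChar.sum_eq_ite ((ZMod.stdAddChar (N := p)).compAddMonoidHom f)
  -- The standard character is injective on `ZMod p`, so it is trivial on the image of `f` only if
  -- `f` itself is zero.
  have hu : (ZMod.stdAddChar (N := p)).compAddMonoidHom f = 0 ↔ u ∈ dotDual W := by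
    rw [mem_dotDual]
    constructor
    · intro h w hw
      have := DFunLike.congr_fun h (⟨w, hw⟩ : W)
      rw [AddChar.compAddMonoidHom_apply, AddChar.zero_apply, hf,
        ← AddChar.map_zero_eq_one (ZMod.stdAddChar (N := p))] at this
      exact ZMod.injective_stdAddChar this
    · intro h
      ext w
      rw [AddChar.compAddMonoidHom_apply, AddChar.zero_apply, hf, h w w.2,
        AddChar.map_zero_eq_one]
  rw [← Finset.sum_filter, ← Finset.sum_subtype_eq_sum_filter]
  rw [if_congr hu rfl rfl, ← Nat.card_eq_fintype_card] at key
  rw [← key]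
  refine (Finset.sum_bij' (fun w _ => ⟨w.1, by simp⟩)
    (fun w _ => ⟨w.1, by simp⟩) ?_ ?_ ?_ ?_ ?_) <;> simp [hf]

open scoped Classical in
/-- The Fourier dual of a weighted multifold partition. -/
lemma dual_weighted_partition {ι : Type*} [Fintype ι]
    (W : ι → Submodule (ZMod p) (Fin m → ZMod p)) (a : ι → ℚ) (c : ℚ)
    (h : ∀ v ≠ 0, ∑ b, (if v ∈ W b then a b else 0) = c) (u : Fin m → ZMod p) (hu : u ≠ 0) :
    ∑ b, (if u ∈ dotDual (W b) then a b * Nat.card (W b) else 0) = ∑ b, a b - c := by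
  have htop : ∑ w : Fin m → ZMod p, (ZMod.stdAddChar (u ⬝ᵥ w) : ℂ) = 0 := by
    have := sum_stdAddChar_dotProduct (⊤ : Submodule (ZMod p) (Fin m → ZMod p)) u
    rw [if_neg] at this
    · simpa using this
    · exact fun h => hu (dotProduct_eq_zero u fun w => h w trivial)
  have h1 : ∑ w : Fin m → ZMod p,
      ((∑ b, (if w ∈ W b then a b else 0) : ℚ) : ℂ) * ZMod.stdAddChar (u ⬝ᵥ w) =
      ((∑ b, a b - c : ℚ) : ℂ) := by
    -- The weighted indicator is the constant `c` plus a spike at the origin, where all subspaces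
    -- meet. The constant is killed by `htop`, and only the spike survives.
    have : ∀ w : Fin m → ZMod p,
        ((∑ b, (if w ∈ W b then a b else 0) : ℚ) : ℂ) * ZMod.stdAddChar (u ⬝ᵥ w) =
        (c : ℂ) * ZMod.stdAddChar (u ⬝ᵥ w) +
          if w = 0 then ((∑ b, a b - c : ℚ) : ℂ) else 0 := by
      intro w
      by_cases hw : w = 0
      · subst hw
        simp
      · rw [h w hw, if_neg hw, add_zero]
    rw [Finset.sum_congr rfl fun w _ => this w, Finset.sum_add_distrib, ← Finset.mul_sum, htop]
    simp
  have h2 : ∑ w : Fin m → ZMod p,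
      ((∑ b, (if w ∈ W b then a b else 0) : ℚ) : ℂ) * ZMod.stdAddChar (u ⬝ᵥ w) =
      ((∑ b, (if u ∈ dotDual (W b) then a b * Nat.card (W b) else 0) : ℚ) : ℂ) := by
    push_cast
    simp_rw [Finset.sum_mul]
    rw [Finset.sum_comm]
    refine Finset.sum_congr rfl fun b _ => ?_
    have := sum_stdAddChar_dotProduct (W b) u
    have h3 : ((if u ∈ dotDual (W b) then a b * Nat.card (W b) else 0 : ℚ) : ℂ) =
        a b * (if u ∈ dotDual (W b) then (Nat.card (W b) : ℂ) else 0) := by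
      split_ifs <;> push_cast <;> simp
    rw [h3, ← this, Finset.mul_sum]
    refine Finset.sum_congr rfl fun w _ => ?_
    split_ifs <;> simp
  exact_mod_cast h2.symm.trans h1

lemma natCard_submodule_zmod (W : Submodule (ZMod p) (Fin m → ZMod p)) :
    Nat.card W = p ^ Module.finrank (ZMod p) W := by
  classical
  rw [Nat.card_eq_fintype_card, Module.card_eq_pow_finrank (K := ZMod p), ZMod.card]

open scoped Classical in
/-- Counting the nonzero vectors in the members of a family of subspaces. -/
lemma sum_nonzero_weighted_mem {ι : Type*} [Fintype ι]
    (W : ι → Submodule (ZMod p) (Fin m → ZMod p)) (a : ι → ℚ) :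
    ∑ v ∈ Finset.univ.filter (fun v : Fin m → ZMod p => v ≠ 0),
      ∑ b, (if v ∈ W b then a b else 0) =
      ∑ b, a b * ((p : ℚ) ^ Module.finrank (ZMod p) (W b) - 1) := by
  rw [Finset.sum_comm]
  refine Finset.sum_congr rfl fun b _ => ?_
  rw [← Finset.sum_filter, Finset.sum_const, nsmul_eq_mul, mul_comm]
  congr 1
  have h0 : (Finset.univ.filter fun v : Fin m → ZMod p => v ∈ W b).card =
      p ^ Module.finrank (ZMod p) (W b) := by
    rw [← natCard_submodule_zmod, Nat.card_eq_fintype_card, Fintype.card_subtype]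
  have h1 : (Finset.univ.filter fun v : Fin m → ZMod p => v ≠ 0).filter (fun v => v ∈ W b) =
      (Finset.univ.filter fun v : Fin m → ZMod p => v ∈ W b).erase 0 := by
    ext v
    simp
  rw [h1, Finset.card_erase_of_mem (by simp), h0,
    Nat.cast_sub (Nat.one_le_pow _ _ (Fact.out : p.Prime).pos)]
  simp

lemma card_nonzero_fin_zmod :
    (((Finset.univ.filter fun v : Fin m → ZMod p => v ≠ 0).card : ℕ) : ℚ) = (p : ℚ) ^ m - 1 := by
  rw [Finset.filter_ne' Finset.univ (0 : Fin m → ZMod p), Finset.card_erase_of_mem (by simp),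
    Finset.card_univ, Fintype.card_fun, ZMod.card, Fintype.card_fin,
    Nat.cast_sub (Nat.one_le_pow _ _ (Fact.out : p.Prime).pos)]
  simp

end Characters

/-! ### Blocks of a check matrix -/

section Blocks

variable {p s m : ℕ} {n : ℕ → ℕ}

/-- The submatrix formed by the columns in the block `b`. -/
def blockMatrix (H : Matrix (Fin m) (BlockColumn s n) (ZMod p)) (b : Block s n) :
    Matrix (Fin m) (Fin b.size) (ZMod p) :=
  H.submatrix id fun l => ⟨b, l⟩

/-- The combination of the rows of `H` with coefficients `u`. -/
def rowWord (H : Matrix (Fin m) (BlockColumn s n) (ZMod p)) (u : Fin m → ZMod p) :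
    BlockSpace p s n :=
  fun b => Matrix.vecMul u (blockMatrix H b)

/-- The syndrome map of the check matrix `H`. -/
def syndrome (H : Matrix (Fin m) (BlockColumn s n) (ZMod p)) :
    BlockSpace p s n →ₗ[ZMod p] (Fin m → ZMod p) :=
  ∑ b, (blockMatrix H b).mulVecLin.comp (LinearMap.proj b)

variable (H : Matrix (Fin m) (BlockColumn s n) (ZMod p))

lemma syndrome_apply (x : BlockSpace p s n) :
    syndrome H x = ∑ b, (blockMatrix H b).mulVec (x b) := by
  simp [syndrome]

lemma syndrome_eq_mulVec (x : BlockSpace p s n) :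
    syndrome H x = H.mulVec fun c => x c.1 c.2 := by
  rw [syndrome_apply]
  ext r
  simp only [Finset.sum_apply, Matrix.mulVec, dotProduct, Fintype.sum_sigma]
  rfl

lemma mem_nullCode {x : BlockSpace p s n} : x ∈ nullCode H ↔ syndrome H x = 0 := by
  rw [syndrome_eq_mulVec]
  rfl

lemma dotProduct_syndrome (u : Fin m → ZMod p) (x : BlockSpace p s n) :
    u ⬝ᵥ syndrome H x = ∑ b, rowWord H u b ⬝ᵥ x b := by
  rw [syndrome_apply, dotProduct_sum]
  exact Finset.sum_congr rfl fun b _ => Matrix.dotProduct_mulVec _ _ _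

lemma mem_rowCode {c : BlockSpace p s n} : c ∈ rowCode H ↔ ∃ u, rowWord H u = c := by
  rw [rowCode, Submodule.mem_span_range_iff_exists_fun]
  refine exists_congr fun u => ?_
  have : ∑ r, u r • (fun (b : Block s n) (l : Fin b.size) => H r ⟨b, l⟩ : BlockSpace p s n) =
      rowWord H u := by
    ext b l
    simp [rowWord, Matrix.vecMul, dotProduct, blockMatrix, Finset.sum_apply]
  rw [this]

lemma syndrome_single [DecidableEq (Block s n)] (b : Block s n) (e : BlockAlphabet p b) :
    syndrome H (Pi.single b e) = (blockMatrix H b).mulVec e := by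
  rw [syndrome_apply, Finset.sum_eq_single b]
  · simp
  · intro b' _ hb'
    rw [Pi.single_eq_of_ne hb', Matrix.mulVec_zero]
  · simp

variable [Fact p.Prime]

lemma blockSpan_eq_range (b : Block s n) :
    blockSpan H b = LinearMap.range (blockMatrix H b).mulVecLin := by
  rw [Matrix.range_mulVecLin]
  rfl

lemma mem_blockSpan {b : Block s n} {v : Fin m → ZMod p} :
    v ∈ blockSpan H b ↔ ∃ e, (blockMatrix H b).mulVec e = v := by
  rw [blockSpan_eq_range]
  rfl

lemma finrank_blockSpan (b : Block s n) :
    Module.finrank (ZMod p) (blockSpan H b) = (blockMatrix H b).rank := by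
  rw [blockSpan_eq_range]
  rfl

lemma finrank_blockSpan_le_size (b : Block s n) :
    Module.finrank (ZMod p) (blockSpan H b) ≤ b.size := by
  rw [finrank_blockSpan]
  exact (Matrix.rank_le_width _)

lemma finrank_blockSpan_le (b : Block s n) : Module.finrank (ZMod p) (blockSpan H b) ≤ m := by
  rw [finrank_blockSpan]
  exact (Matrix.rank_le_height _)

/-- Pairing $u$ with a combination of the columns of the block is pairing the row word at that block
with the coefficients. This is the dictionary between codeword weights and dual subspaces. -/
lemma rowWord_apply_eq_zero_iff {u : Fin m → ZMod p} {b : Block s n} :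
    rowWord H u b = 0 ↔ u ∈ dotDual (blockSpan H b) := by
  rw [mem_dotDual]
  constructor
  · intro h w hw
    obtain ⟨e, rfl⟩ := (mem_blockSpan H).1 hw
    rw [Matrix.dotProduct_mulVec]
    exact (congrArg (· ⬝ᵥ e) h).trans (zero_dotProduct e)
  · intro h
    refine dotProduct_eq_zero _ fun e => ?_
    rw [rowWord, ← Matrix.dotProduct_mulVec]
    exact h _ ((mem_blockSpan H).2 ⟨e, rfl⟩)

variable {H}

lemma syndrome_surjective (hH : H.rank = m) : Function.Surjective (syndrome H) := by
  have htop : LinearMap.range H.mulVecLin = ⊤ :=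
    Submodule.eq_top_of_finrank_eq (by rw [Module.finrank_fin_fun]; exact hH)
  intro y
  obtain ⟨x, hx⟩ := LinearMap.range_eq_top.1 htop y
  exact ⟨fun b l => x ⟨b, l⟩, by rw [syndrome_eq_mulVec]; exact hx⟩

lemma eq_zero_of_rowWord_eq_zero (hH : H.rank = m) {u : Fin m → ZMod p} (hu : rowWord H u = 0) :
    u = 0 := by
  refine dotProduct_eq_zero u fun y => ?_
  obtain ⟨x, rfl⟩ := syndrome_surjective hH y
  rw [dotProduct_syndrome, hu]
  simp

/-- Row rank equals column rank, so a block with independent columns has rows spanning its whole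
alphabet. -/
lemma isAlphabetEffective_rowCode
    (h : ∀ b, Module.finrank (ZMod p) (blockSpan H b) = b.size) :
    IsAlphabetEffective (rowCode H) := by
  intro b a
  have htop : LinearMap.range (blockMatrix H b).transpose.mulVecLin = ⊤ := by
    refine Submodule.eq_top_of_finrank_eq ?_
    exact (Matrix.rank_transpose (blockMatrix H b)).trans <|
      ((finrank_blockSpan H b).symm.trans (h b)).trans (Module.finrank_fin_fun _).symm
  obtain ⟨u, hu⟩ := LinearMap.range_eq_top.1 htop a
  refine ⟨rowWord H u, (mem_rowCode H).2 ⟨u, rfl⟩, ?_⟩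
  rw [← hu, Matrix.mulVecLin_apply, Matrix.mulVec_transpose]
  rfl

lemma blockMatrix_mulVec_injective {b : Block s n}
    (h : Module.finrank (ZMod p) (blockSpan H b) = b.size) :
    Function.Injective (blockMatrix H b).mulVec := by
  rw [blockSpan_eq_range] at h
  have hk := LinearMap.finrank_range_add_finrank_ker (blockMatrix H b).mulVecLin
  rw [h, Module.finrank_fin_fun, Nat.add_eq_left, Submodule.finrank_eq_zero] at hk
  exact LinearMap.ker_eq_bot.1 hk

variable (H)

open scoped Classical in
lemma blockWeight_rowWord (u : Fin m → ZMod p) :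
    (blockWeight (rowWord H u) : ℚ) =
      Fintype.card (Block s n) - ∑ b, (if u ∈ dotDual (blockSpan H b) then (1 : ℚ) else 0) := by
  have h1 : (blockWeight (rowWord H u) : ℚ) =
      ∑ b, (if u ∈ dotDual (blockSpan H b) then (0 : ℚ) else 1) := by
    rw [blockWeight, Finset.card_filter]
    push_cast
    refine Finset.sum_congr rfl fun b _ => ?_
    simp only [ne_eq, rowWord_apply_eq_zero_iff]
    split_ifs <;> simp_all
  rw [h1, eq_sub_iff_add_eq, ← Finset.sum_add_distrib,
    Finset.sum_congr rfl (g := fun _ => (1 : ℚ)) fun b _ => by split_ifs <;> norm_num]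
  simp

open scoped Classical in
lemma isFoldPartition_blockMultiset_iff (c : ℚ) :
    IsFoldPartition (blockMultiset H) c ↔
      ∀ v ≠ 0, ∑ b : Block s n, (if v ∈ blockSpan H b then (p : ℚ) ^ (s - b.size) else 0) = c := by
  refine forall₂_congr fun v _ => ?_
  have : ((blockMultiset H).countP fun W => v ∈ W) =
      ∑ b : Block s n, (if v ∈ blockSpan H b then p ^ (s - b.size) else 0) := by
    rw [blockMultiset, ← Multiset.coe_countPAddMonoidHom, map_sum]
    refine Finset.sum_congr rfl fun b _ => ?_
    rw [Multiset.coe_countPAddMonoidHom]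
    split_ifs with h
    · rw [Multiset.countP_eq_card.2 fun W hW => (Multiset.eq_of_mem_replicate hW).symm ▸ h,
        Multiset.card_replicate]
    · exact Multiset.countP_eq_zero.2 fun W hW => (Multiset.eq_of_mem_replicate hW).symm ▸ h
  rw [this]
  push_cast
  rfl

open scoped Classical in
lemma isFoldPartition_dualBlockMultiset_iff (c : ℚ) :
    IsFoldPartition (dualBlockMultiset H) c ↔
      ∀ u ≠ 0, ∑ b, (if u ∈ dotDual (blockSpan H b) then (1 : ℚ) else 0) = c := by
  refine forall₂_congr fun v _ => ?_
  rw [dualBlockMultiset, Multiset.countP_map, Finset.sum_boole]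
  rfl

end Blocks

/-! ### Orthogonal arrays from null spaces -/

section OrthogonalArray

/-- The fibers of a surjective homomorphism of finite groups have the same size. -/
lemma card_fiber_mul_card {A B : Type*} [AddCommGroup A] [AddCommGroup B] [Fintype A] [Fintype B]
    [DecidableEq B] (f : A →+ B) (hf : Function.Surjective f) (y : B) :
    (Finset.univ.filter fun x => f x = y).card * Fintype.card B = Fintype.card A := by
  have h := Finset.card_eq_sum_card_fiberwise (f := f) (s := Finset.univ) (t := Finset.univ)
    fun _ _ => Finset.mem_coe.2 (Finset.mem_univ _)
  rw [Finset.card_univ] at h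
  rw [h, Finset.sum_congr rfl (g := fun _ => (Finset.univ.filter fun x => f x = y).card),
    Finset.sum_const, Finset.card_univ, smul_eq_mul, mul_comm]
  intro z _
  have := AddMonoidHom.card_fiber_eq_of_mem_range f (x := z) (y := y) (hf z) (hf y)
  simpa using this

variable {p s m : ℕ} {n : ℕ → ℕ} [Fact p.Prime]

lemma card_blockAlphabet (b : Block s n) :
    Fintype.card (BlockAlphabet p b) = p ^ b.size := by
  rw [Fintype.card_fun, ZMod.card, Fintype.card_fin]

variable {H : Matrix (Fin m) (BlockColumn s n) (ZMod p)}

lemma card_codeMultiset_mul (hH : H.rank = m) :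
    (codeMultiset (nullCode H)).card * p ^ m = Fintype.card (BlockSpace p s n) := by
  classical
  have h := card_fiber_mul_card (syndrome H).toAddMonoidHom (syndrome_surjective hH) 0
  rw [Fintype.card_fun (β := ZMod p), ZMod.card, Fintype.card_fin] at h
  rw [← h, codeMultiset, Finset.card_val]
  congr 2
  ext x
  rw [Finset.mem_filter, Finset.mem_filter, mem_nullCode]
  rfl

lemma codeMultiset_ne_zero (C : Submodule (ZMod p) (BlockSpace p s n)) : codeMultiset C ≠ 0 := by
  classical
  intro h
  have : (0 : BlockSpace p s n) ∈ codeMultiset C := by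
    simp [codeMultiset]
  rw [h] at this
  exact Multiset.notMem_zero _ this

/-- A vector $u$ orthogonal to all syndromes of words vanishing on `T` has its row word supported in
`T`. The weight hypothesis leaves only $u=0$. -/
lemma exists_mem_ker_extension {T : Finset (Block s n)}
    (hT : ∀ u ≠ 0, T.card < blockWeight (rowWord H u)) (y : Fin m → ZMod p) :
    ∃ x : BlockSpace p s n, (∀ b ∈ T, x b = 0) ∧ syndrome H x = y := by
  classical
  let Z : Submodule (ZMod p) (BlockSpace p s n) :=
    { carrier := {x | ∀ b ∈ T, x b = 0}
      add_mem' := fun hx hy b hb => by rw [Pi.add_apply, hx b hb, hy b hb, add_zero]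
      zero_mem' := fun b _ => rfl
      smul_mem' := fun c x hx b hb => by rw [Pi.smul_apply, hx b hb, smul_zero] }
  have htop : Z.map (syndrome H) = ⊤ := by
    refine eq_top_of_forall_dotProduct_eq_zero fun u hu => ?_
    by_contra hu0
    refine (hT u hu0).not_ge (Finset.card_le_card fun b hb => ?_)
    by_contra hbT
    refine (Finset.mem_filter.1 hb).2 ((rowWord_apply_eq_zero_iff H).2 fun w hw => ?_)
    obtain ⟨e, rfl⟩ := (mem_blockSpan H).1 hw
    rw [← syndrome_single]
    refine hu _ (Submodule.mem_map_of_mem fun b' hb' => ?_)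
    exact Pi.single_eq_of_ne (fun h => hbT (by rwa [← h])) _
  obtain ⟨x, hx, hxy⟩ : y ∈ Z.map (syndrome H) := htop ▸ Submodule.mem_top
  exact ⟨x, hx, hxy⟩

/-- Syndrome and restriction to `T` together form a surjective homomorphism, so all its fibers have
the same size. -/
lemma isOrthogonalArray_nullCode (hH : H.rank = m) {t : ℕ} (ht : t ≤ Fintype.card (Block s n))
    (hw : ∀ u ≠ 0, t < blockWeight (rowWord H u)) :
    IsOrthogonalArray (A := BlockAlphabet p) (codeMultiset (nullCode H)) t := by
  classical
  refine ⟨codeMultiset_ne_zero _, ht, fun T hT a => ?_⟩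
  let f : BlockSpace p s n →+ (Fin m → ZMod p) × (∀ i : T, BlockAlphabet p i.1) :=
    (syndrome H).toAddMonoidHom.prod
      { toFun := fun x i => x i
        map_zero' := rfl
        map_add' := fun _ _ => rfl }
  have hf : Function.Surjective f := by
    rintro ⟨y, a⟩
    -- `x₀` realizes the prescribed values; a word vanishing on `T` then corrects the syndrome
    -- without disturbing them.
    let x₀ : BlockSpace p s n := fun b => if hb : b ∈ T then a ⟨b, hb⟩ else 0
    obtain ⟨x, hx, hxy⟩ := exists_mem_ker_extension (H := H) (T := T)
      (fun u hu => hT ▸ hw u hu) (y - syndrome H x₀)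
    refine ⟨x + x₀, Prod.ext ?_ ?_⟩
    · exact ((syndrome H).map_add _ _).trans (by rw [hxy, sub_add_cancel])
    · funext i
      change x i + x₀ i = a i
      rw [hx i i.2, zero_add]
      exact dif_pos i.2
  have h := card_fiber_mul_card f hf (0, a)
  rw [Fintype.card_prod, Fintype.card_fun (β := ZMod p), ZMod.card, Fintype.card_fin,
    ← card_codeMultiset_mul hH, Fintype.card_pi] at h
  have hcount : (codeMultiset (nullCode H)).countP (fun x => ∀ i : T, x i = a i) =
      (Finset.univ.filter fun x => f x = (0, a)).card := by
    rw [codeMultiset, Multiset.countP_eq_card_filter, ← Finset.filter_val, Finset.card_val,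
      Finset.filter_filter]
    congr 1
    ext x
    simp only [Finset.mem_filter, Finset.mem_univ, true_and, Prod.ext_iff, mem_nullCode]
    exact and_congr Iff.rfl funext_iff.symm
  have hprod : ∏ i : T, Fintype.card (BlockAlphabet p i.1) =
      ∏ i ∈ T, Fintype.card (BlockAlphabet p i) :=
    Finset.prod_coe_sort T fun i => Fintype.card (BlockAlphabet p i)
  rw [hprod, ← mul_assoc, mul_right_comm] at h
  have h' := Nat.eq_of_mul_eq_mul_right (pow_pos (Fact.out : p.Prime).pos m) h
  have hne : (∏ i ∈ T, (Fintype.card (BlockAlphabet p i) : ℚ)) ≠ 0 :=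
    Finset.prod_ne_zero_iff.2 fun i _ => Nat.cast_ne_zero.2 Fintype.card_ne_zero
  rw [eq_div_iff hne, ← h', ← hcount]
  push_cast
  congr

/-- A nonzero dual codeword supported in a set `T` of `t` positions is a parity check on these
positions alone, so a pattern violating it never occurs in the code. -/
lemma lt_blockWeight_of_isOrthogonalArray (hH : H.rank = m) {t : ℕ}
    (h : IsOrthogonalArray (A := BlockAlphabet p) (codeMultiset (nullCode H)) t)
    {u : Fin m → ZMod p} (hu : u ≠ 0) : t < blockWeight (rowWord H u) := by
  classical
  obtain ⟨h0, ht, hOA⟩ := h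
  by_contra! hle
  obtain ⟨T, hsub, hT⟩ := Finset.exists_superset_card_eq hle ht
  obtain ⟨b₀, hb₀⟩ : ∃ b, rowWord H u b ≠ 0 := by
    by_contra! hz
    exact hu (eq_zero_of_rowWord_eq_zero hH (funext hz))
  obtain ⟨e, he⟩ : ∃ e, rowWord H u b₀ ⬝ᵥ e ≠ 0 := by
    by_contra! hz
    exact hb₀ (dotProduct_eq_zero _ hz)
  -- The only nonzero entry of this pattern pairs nontrivially with the dual codeword, so the check
  -- fails.
  let a : BlockSpace p s n := Pi.single b₀ e
  have hpos : (0 : ℚ) < (codeMultiset (nullCode H)).card /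
      ∏ i ∈ T, (Fintype.card (BlockAlphabet p i) : ℚ) :=
    div_pos (Nat.cast_pos.2 (Multiset.card_pos.2 h0))
      (Finset.prod_pos fun i _ => Nat.cast_pos.2 Fintype.card_pos)
  rw [← hOA T hT fun i => a i, Nat.cast_pos] at hpos
  obtain ⟨x, hx, hxa⟩ := (@Multiset.countP_pos _ _ (_) _).1 hpos
  have hxC : syndrome H x = 0 := by
    rw [← mem_nullCode]
    exact (Finset.mem_filter.1 hx).2
  have hdot := dotProduct_syndrome H u x
  rw [hxC, dotProduct_zero, Finset.sum_eq_single b₀] at hdot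
  · have hb : b₀ ∈ T := hsub (Finset.mem_filter.2 ⟨Finset.mem_univ _, hb₀⟩)
    rw [hxa ⟨b₀, hb⟩] at hdot
    refine he (Eq.trans ?_ hdot.symm)
    simp [a]
  · intro b _ hb
    by_cases hbT : b ∈ T
    · rw [hxa ⟨b, hbT⟩]
      simp [a, hb]
    · have : rowWord H u b = 0 := by
        by_contra hz
        exact hbT (hsub (Finset.mem_filter.2 ⟨Finset.mem_univ _, hz⟩))
      rw [this, zero_dotProduct]
  · simp

end OrthogonalArray

/-! ### Completely regular codes from null spaces -/

section CompletelyRegular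

variable {p s m : ℕ} {n : ℕ → ℕ} [Fact p.Prime]

lemma block_size_le (b : Block s n) : b.size ≤ s := (Finset.mem_Icc.1 b.1.2).2

lemma lcm_card_blockAlphabet (hs : 1 ≤ s) (hn : 1 ≤ n s) :
    (Finset.univ.lcm fun b : Block s n => Fintype.card (BlockAlphabet p b)) = p ^ s := by
  refine Nat.dvd_antisymm (Finset.lcm_dvd fun b _ => ?_) ?_
  · rw [card_blockAlphabet]
    exact pow_dvd_pow p (block_size_le b)
  · let b : Block s n := ⟨⟨s, Finset.mem_Icc.2 ⟨hs, le_rfl⟩⟩, ⟨0, hn⟩⟩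
    have h := Finset.dvd_lcm (f := fun b : Block s n => Fintype.card (BlockAlphabet p b))
      (Finset.mem_univ b)
    rwa [card_blockAlphabet b] at h

/-- The number of edges to a set, sorted by the position in which the edges change the tuple. -/
lemma edgesTo_hammingMultigraph (hs : 1 ≤ s) (hn : 1 ≤ n s) {x : BlockSpace p s n}
    {S : Set (BlockSpace p s n)} {P : ∀ b : Block s n, BlockAlphabet p b → Prop}
    [DecidableEq (Block s n)] [∀ b, DecidablePred (P b)] (hP : ∀ b e, P b e ↔ e ≠ 0 ∧ x + Pi.single b e ∈ S) :
    (hammingMultigraph (fun b : Block s n => BlockAlphabet p b)).edgesTo x S =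
      ∑ b : Block s n, p ^ (s - b.size) *
        (Finset.univ.filter (P b)).card := by
  classical
  rw [EdgeMultigraph.edgesTo]
  simp only [hammingMultigraph]
  rw [Finset.sum_comm]
  refine Finset.sum_congr rfl fun b _ => ?_
  rw [lcm_card_blockAlphabet hs hn, card_blockAlphabet b,
    Nat.pow_div (block_size_le b) (Fact.out : p.Prime).pos, ← Finset.sum_filter,
    Finset.sum_const, smul_eq_mul, mul_comm, Finset.filter_filter]
  congr 1
  -- A neighbor differing from `x` only in position `b` is encoded by its difference `e` there.
  refine Finset.card_nbij' (fun y => y b - x b) (fun e => x + Pi.single b e) ?_ ?_ ?_ ?_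
  · rintro y hy
    simp only [Finset.coe_filter, Finset.mem_univ, true_and, Set.mem_ofPred_eq, hP] at hy ⊢
    have : x + Pi.single b (y b - x b) = y := by
      funext j
      by_cases hj : j = b
      · subst hj
        simp
      · simp [hj, hy.2.2 j hj]
    exact ⟨sub_ne_zero.2 (Ne.symm hy.2.1), this.symm ▸ hy.1⟩
  · rintro e he
    simp only [Finset.coe_filter, Finset.mem_univ, true_and, Set.mem_ofPred_eq, hP] at he ⊢
    refine ⟨he.2, ?_, fun j hj => ?_⟩
    · simpa [eq_comm] using he.1
    · simp [hj]
  · rintro y hy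
    simp only [Finset.coe_filter, Finset.mem_univ, true_and, Set.mem_ofPred_eq] at hy
    funext j
    by_cases hj : j = b
    · subst hj
      simp
    · simp [hj, hy.2.2 j hj]
  · intro e _
    simp

lemma card_ne_zero_blockAlphabet (b : Block s n) :
    (Finset.univ.filter fun e : BlockAlphabet p b => e ≠ 0).card = p ^ b.size - 1 := by
  rw [Finset.filter_ne', Finset.card_erase_of_mem (Finset.mem_univ _), Finset.card_univ,
    card_blockAlphabet]

lemma isRegular_hammingMultigraph (hs : 1 ≤ s) (hn : 1 ≤ n s) :
    (hammingMultigraph (fun b : Block s n => BlockAlphabet p b)).IsRegular := by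
  classical
  refine ⟨∑ b : Block s n, p ^ (s - b.size) * (p ^ b.size - 1), fun x => ?_⟩
  have h := edgesTo_hammingMultigraph hs hn (x := x) (S := Set.univ) (P := fun _ e => e ≠ 0)
    fun _ _ => (and_iff_left (Set.mem_univ _)).symm
  rw [EdgeMultigraph.edgesTo] at h
  simp only [Set.mem_univ, Finset.filter_true] at h
  rw [h]
  exact Finset.sum_congr rfl fun b _ => by rw [← card_ne_zero_blockAlphabet]

variable {H : Matrix (Fin m) (BlockColumn s n) (ZMod p)}

lemma add_single_mem_nullCode [DecidableEq (Block s n)] {x : BlockSpace p s n} {b : Block s n}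
    {e : BlockAlphabet p b} :
    x + Pi.single b e ∈ nullCode H ↔ syndrome H x + (blockMatrix H b).mulVec e = 0 := by
  rw [mem_nullCode, map_add, syndrome_single]

/-- The assumed count is the whole degree, so no neighbor of $0$ is a codeword. A nonzero kernel
vector of a block would give such a neighbor. -/
lemma mulVec_injective_of_edgesTo_compl (hs : 1 ≤ s) (hn : 1 ≤ n s)
    (h : (hammingMultigraph (fun b : Block s n => BlockAlphabet p b)).edgesTo 0
      (nullCode H : Set (BlockSpace p s n))ᶜ = ∑ b : Block s n, p ^ (s - b.size) * (p ^ b.size - 1))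
    (b : Block s n) : Function.Injective (blockMatrix H b).mulVec := by
  classical
  have hP : ∀ (b : Block s n) (e : BlockAlphabet p b), (e ≠ 0 ∧ (blockMatrix H b).mulVec e ≠ 0) ↔
      e ≠ 0 ∧ 0 + Pi.single b e ∈ (nullCode H : Set (BlockSpace p s n))ᶜ := by
    intro b e
    rw [Set.mem_compl_iff, SetLike.mem_coe, add_single_mem_nullCode, map_zero, zero_add]
  rw [edgesTo_hammingMultigraph hs hn hP] at h
  simp_rw [← card_ne_zero_blockAlphabet] at h
  have hsub : ∀ b : Block s n,
      (Finset.univ.filter fun e : BlockAlphabet p b => e ≠ 0 ∧ (blockMatrix H b).mulVec e ≠ 0) ⊆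
        Finset.univ.filter fun e : BlockAlphabet p b => e ≠ 0 :=
    fun b e he => Finset.mem_filter.2 ⟨Finset.mem_univ _, (Finset.mem_filter.1 he).2.1⟩
  have h1 : (Finset.univ.filter fun e : BlockAlphabet p b =>
        e ≠ 0 ∧ (blockMatrix H b).mulVec e ≠ 0).card =
      (Finset.univ.filter fun e : BlockAlphabet p b => e ≠ 0).card := by
    refine Nat.eq_of_mul_eq_mul_left (pow_pos (Fact.out : p.Prime).pos (s - b.size)) ?_
    exact (Finset.sum_eq_sum_iff_of_le fun (b : Block s n) _ => Nat.mul_le_mul_left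
      (p ^ (s - b.size)) (Finset.card_le_card (hsub b))).1 h b (Finset.mem_univ b)
  have h2 := Finset.eq_of_subset_of_card_le (hsub b) h1.ge
  intro e₁ e₂ he
  by_contra hne
  have h3 : e₁ - e₂ ∈ Finset.univ.filter fun e : BlockAlphabet p b => e ≠ 0 := by
    simpa using sub_ne_zero.2 hne
  rw [← h2] at h3
  refine (Finset.mem_filter.1 h3).2.2 ?_
  rw [Matrix.mulVec_sub, sub_eq_zero]
  exact he

lemma edgesTo_compl_nullCode (hs : 1 ≤ s) (hn : 1 ≤ n s)
    (hinj : ∀ b, Function.Injective (blockMatrix H b).mulVec) {x : BlockSpace p s n}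
    (hx : x ∈ nullCode H) :
    (hammingMultigraph (fun b : Block s n => BlockAlphabet p b)).edgesTo x
      (nullCode H : Set (BlockSpace p s n))ᶜ =
        ∑ b : Block s n, p ^ (s - b.size) * (p ^ b.size - 1) := by
  classical
  rw [edgesTo_hammingMultigraph hs hn (P := fun _ e => e ≠ 0)]
  · exact Finset.sum_congr rfl fun b _ => by rw [← card_ne_zero_blockAlphabet]
  · intro b e
    refine (and_iff_left_of_imp fun he hmem => he ?_).symm
    rw [SetLike.mem_coe, add_single_mem_nullCode, (mem_nullCode H).1 hx, zero_add,
      ← Matrix.mulVec_zero (blockMatrix H b)] at hmem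
    exact hinj b hmem

open scoped Classical in
-- Changing `x` at block `b` lands in the code iff the change solves a linear system with right side
-- minus the syndrome. Injectivity leaves at most one solution.
lemma edgesTo_nullCode (hs : 1 ≤ s) (hn : 1 ≤ n s)
    (hinj : ∀ b, Function.Injective (blockMatrix H b).mulVec) {x : BlockSpace p s n}
    (hx : x ∉ nullCode H) :
    (hammingMultigraph (fun b : Block s n => BlockAlphabet p b)).edgesTo x (nullCode H) =
      ∑ b : Block s n, if syndrome H x ∈ blockSpan H b then p ^ (s - b.size) else 0 := by
  have hP : ∀ (b : Block s n) (e : BlockAlphabet p b),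
      (blockMatrix H b).mulVec e = -syndrome H x ↔
        (e ≠ 0 ∧ x + Pi.single b e ∈ (nullCode H : Set (BlockSpace p s n))) := by
    intro b e
    rw [SetLike.mem_coe, add_single_mem_nullCode, add_comm, ← eq_neg_iff_add_eq_zero]
    refine (and_iff_right_of_imp fun he h0 => hx ?_).symm
    rwa [h0, Matrix.mulVec_zero, eq_comm, neg_eq_zero, ← mem_nullCode] at he
  rw [edgesTo_hammingMultigraph hs hn hP]
  refine Finset.sum_congr rfl fun b _ => ?_
  split_ifs with h
  · obtain ⟨e, he⟩ := (mem_blockSpan H).1 h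
    rw [Finset.card_eq_one.2 ⟨-e, ?_⟩, mul_one]
    ext e'
    rw [Finset.mem_filter, Finset.mem_singleton, ← he, ← Matrix.mulVec_neg, (hinj b).eq_iff]
    simp
  · rw [Finset.card_eq_zero.2, mul_zero]
    refine Finset.filter_eq_empty_iff.2 fun e _ he => h ((mem_blockSpan H).2 ⟨-e, ?_⟩)
    rw [Matrix.mulVec_neg, he, neg_neg]

end CompletelyRegular

/-! ### The equivalences -/

section Equivalence

variable {p s m : ℕ} {n : ℕ → ℕ}

lemma sum_block_size (f : ℕ → ℚ) :
    ∑ b : Block s n, f b.size = ∑ i ∈ Finset.Icc 1 s, (n i : ℚ) * f i := by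
  rw [Fintype.sum_sigma, ← Finset.sum_coe_sort _ fun i => (n i : ℚ) * f i]
  refine Finset.sum_congr rfl fun i _ => ?_
  change ∑ _ : Fin (n i), f i = _
  rw [Finset.sum_const, Finset.card_univ, Fintype.card_fin, nsmul_eq_mul]

variable [Fact p.Prime]

lemma one_lt_prime_cast : (1 : ℚ) < p := Nat.one_lt_cast.2 (Fact.out : p.Prime).one_lt

lemma prime_cast_pow_sub (b : Block s n) :
    (p : ℚ) ^ (s - b.size) = (p : ℚ) ^ s / (p : ℚ) ^ b.size := by
  have hp : (p : ℚ) ≠ 0 := (zero_lt_one.trans one_lt_prime_cast).ne'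
  rw [eq_div_iff (pow_ne_zero _ hp), ← pow_add, Nat.sub_add_cancel (block_size_le b)]

variable {H : Matrix (Fin m) (BlockColumn s n) (ZMod p)}

open scoped Classical in
/-- A family of blocks whose duals contain each nonzero vector at most as often as on average for
blocks of full rank consists of blocks of full rank, and attains the average at each vector. -/
lemma finrank_blockSpan_eq_size_of_sum_le {ν : ℚ}
    (hν : ν * ((p : ℚ) ^ m - 1) = ∑ b : Block s n, ((p : ℚ) ^ m / (p : ℚ) ^ b.size - 1))
    (h : ∀ u ≠ 0, ∑ b, (if u ∈ dotDual (blockSpan H b) then (1 : ℚ) else 0) ≤ ν) :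
    (∀ b, Module.finrank (ZMod p) (blockSpan H b) = b.size) ∧
      ∀ u ≠ 0, ∑ b, (if u ∈ dotDual (blockSpan H b) then (1 : ℚ) else 0) = ν := by
  have hp1 : (1 : ℚ) < p := one_lt_prime_cast
  have hp0 : (0 : ℚ) < p := zero_lt_one.trans hp1
  -- Double counting of pairs (nonzero vector, dual containing it). A block of rank $r$ contributes
  -- $p^{m-r}-1$, at least the value for full rank, while the pointwise bound caps the total at the
  -- full-rank sum. The quotient form $p^m/p^i$ also covers $i>m$.
  have htotal := sum_nonzero_weighted_mem (fun b => dotDual (blockSpan H b)) fun _ => (1 : ℚ)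
  have hterm : ∀ b, (1 : ℚ) * ((p : ℚ) ^ Module.finrank (ZMod p) (dotDual (blockSpan H b)) - 1) =
      (p : ℚ) ^ m / (p : ℚ) ^ Module.finrank (ZMod p) (blockSpan H b) - 1 := by
    intro b
    rw [one_mul, finrank_dotDual, eq_comm, sub_left_inj, div_eq_iff (pow_ne_zero _ hp0.ne'),
      ← pow_add, Nat.sub_add_cancel (finrank_blockSpan_le H b)]
  rw [Finset.sum_congr rfl fun b _ => hterm b] at htotal
  have hconst : ∑ u ∈ Finset.univ.filter (fun u : Fin m → ZMod p => u ≠ 0), ν =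
      ∑ b : Block s n, ((p : ℚ) ^ m / (p : ℚ) ^ b.size - 1) := by
    rw [Finset.sum_const, nsmul_eq_mul, card_nonzero_fin_zmod, mul_comm, hν]
  have hle : ∀ b ∈ (Finset.univ : Finset (Block s n)), (p : ℚ) ^ m / (p : ℚ) ^ b.size - 1 ≤
      (p : ℚ) ^ m / (p : ℚ) ^ Module.finrank (ZMod p) (blockSpan H b) - 1 := by
    intro b _
    have := pow_le_pow_right₀ hp1.le (finrank_blockSpan_le_size H b)
    gcongr
  have hle' : ∀ u ∈ Finset.univ.filter (fun u : Fin m → ZMod p => u ≠ 0),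
      ∑ b, (if u ∈ dotDual (blockSpan H b) then (1 : ℚ) else 0) ≤ ν :=
    fun u hu => h u (Finset.mem_filter.1 hu).2
  have hup := Finset.sum_le_sum hle'
  have hdown := Finset.sum_le_sum hle
  constructor
  · intro b
    have hb := (Finset.sum_eq_sum_iff_of_le hle).1 (by linarith) b (Finset.mem_univ b)
    rw [sub_left_inj, div_eq_div_iff (pow_ne_zero _ hp0.ne') (pow_ne_zero _ hp0.ne'),
      mul_right_inj' (pow_ne_zero _ hp0.ne')] at hb
    exact pow_right_injective₀ hp0 hp1.ne' hb
  · intro u hu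
    exact (Finset.sum_eq_sum_iff_of_le hle').1 (by linarith) u (by simpa using hu)

open scoped Classical in
-- Counting incidences with nonzero vectors gives exactly the total for full ranks. No block can
-- exceed its share, so none falls short.
lemma finrank_blockSpan_eq_size_of_isFoldPartition {μ : ℚ}
    (hμ : μ * ((p : ℚ) ^ m - 1) =
      ∑ b : Block s n, (p : ℚ) ^ (s - b.size) * ((p : ℚ) ^ b.size - 1))
    (h : ∀ v ≠ 0, ∑ b : Block s n,
      (if v ∈ blockSpan H b then (p : ℚ) ^ (s - b.size) else 0) = μ) (b : Block s n) :
    Module.finrank (ZMod p) (blockSpan H b) = b.size := by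
  have hp1 : (1 : ℚ) < p := one_lt_prime_cast
  have hp0 : (0 : ℚ) < p := zero_lt_one.trans hp1
  have htotal := sum_nonzero_weighted_mem (blockSpan H)
    fun b : Block s n => (p : ℚ) ^ (s - b.size)
  rw [Finset.sum_congr rfl fun v hv => h v (Finset.mem_filter.1 hv).2, Finset.sum_const,
    nsmul_eq_mul, card_nonzero_fin_zmod, mul_comm, hμ] at htotal
  have hb := (Finset.sum_eq_sum_iff_of_le fun b _ => ?_).1 htotal.symm b (Finset.mem_univ b)
  · rw [mul_right_inj' (pow_ne_zero _ hp0.ne'), sub_left_inj] at hb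
    exact pow_right_injective₀ hp0 hp1.ne' hb
  · have := pow_le_pow_right₀ hp1.le (finrank_blockSpan_le_size H b)
    gcongr

lemma natCard_blockSpan {b : Block s n}
    (h : Module.finrank (ZMod p) (blockSpan H b) = b.size) :
    (Nat.card (blockSpan H b) : ℚ) = (p : ℚ) ^ b.size := by
  rw [natCard_submodule_zmod, h, Nat.cast_pow]

lemma natCard_dotDual_blockSpan {b : Block s n}
    (h : Module.finrank (ZMod p) (blockSpan H b) = b.size) :
    (Nat.card (dotDual (blockSpan H b)) : ℚ) = (p : ℚ) ^ m / (p : ℚ) ^ b.size := by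
  have hp : (p : ℚ) ≠ 0 := (zero_lt_one.trans one_lt_prime_cast).ne'
  rw [natCard_submodule_zmod, finrank_dotDual, h, Nat.cast_pow, eq_div_iff (pow_ne_zero _ hp),
    ← pow_add, Nat.sub_add_cancel (h ▸ finrank_blockSpan_le H b)]

/-- For a code of codimension `m`, the bound is attained for exactly one value of `t`. -/
lemma card_eq_bierbrauerFriedmanBound_iff (hH : H.rank = m)
    (hN : Fintype.card (Block s n) ≠ 0) (t : ℕ) :
    ((codeMultiset (nullCode H)).card : ℚ) =
        bierbrauerFriedmanBound (fun b : Block s n => BlockAlphabet p b) t ↔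
      ((t : ℚ) + 1) * ((p : ℚ) ^ m - 1) =
        (p : ℚ) ^ m * ∑ b : Block s n, (1 - 1 / (p : ℚ) ^ b.size) := by
  have hp1 : (1 : ℚ) < p := one_lt_prime_cast
  have hq0 : (p : ℚ) ^ m ≠ 0 := (pow_pos (zero_lt_one.trans hp1) m).ne'
  have ht : (t : ℚ) + 1 ≠ 0 := by positivity
  have hN' : (Fintype.card (Block s n) : ℚ) ≠ 0 := Nat.cast_ne_zero.2 hN
  have hV : (∏ b : Block s n, (Fintype.card (BlockAlphabet p b) : ℚ)) ≠ 0 :=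
    Finset.prod_ne_zero_iff.2 fun i _ => Nat.cast_ne_zero.2 Fintype.card_ne_zero
  have hcard := card_codeMultiset_mul hH
  rw [Fintype.card_pi] at hcard
  have hcard' : ((codeMultiset (nullCode H)).card : ℚ) * (p : ℚ) ^ m =
      ∏ b : Block s n, (Fintype.card (BlockAlphabet p b) : ℚ) := by
    exact_mod_cast hcard
  have hmean : 1 / harmonicMeanLevel (fun b : Block s n => BlockAlphabet p b) =
      (1 / (Fintype.card (Block s n) : ℚ)) * ∑ b : Block s n, 1 / (p : ℚ) ^ b.size := by
    rw [harmonicMeanLevel, one_div, inv_inv]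
    congr 1
    exact Finset.sum_congr rfl fun b _ => by rw [card_blockAlphabet b, Nat.cast_pow]
  have hsum : ∑ b : Block s n, (1 - 1 / (p : ℚ) ^ b.size) =
      Fintype.card (Block s n) - ∑ b : Block s n, 1 / (p : ℚ) ^ b.size := by
    rw [Finset.sum_sub_distrib]
    simp
  -- Multiplying by $p^m$ turns $|C|$ into $|V|$, which cancels and leaves an equation linear in
  -- $t+1$ after clearing its denominator.
  rw [bierbrauerFriedmanBound, hmean, hsum, ← mul_left_inj' hq0, hcard', mul_assoc,
    left_eq_mul₀ hV]
  generalize ∑ b : Block s n, 1 / (p : ℚ) ^ b.size = S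
  generalize (Fintype.card (Block s n) : ℚ) = N at *
  field_simp
  constructor <;> intro h <;> linear_combination h

end Equivalence

theorem mainTheorem3 (p : ℕ) [Fact p.Prime] (s : ℕ) (hs : 1 ≤ s) (n : ℕ → ℕ) (hn : 1 ≤ n s)
    (m : ℕ) (hm : 1 ≤ m)
    (H : Matrix (Fin m) (BlockColumn s n) (ZMod p)) (hH : H.rank = m)
    (k μ ν : ℚ)
    (hk : k = ∑ i ∈ Finset.Icc 1 s, (n i : ℚ) * ((p : ℚ) ^ s - (p : ℚ) ^ (s - i)))
    (hμ : μ = k / ((p : ℚ) ^ m - 1))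
    (hν : ν = ∑ i ∈ Finset.Icc 1 s, (n i : ℚ) - (p : ℚ) ^ ((m : ℤ) - (s : ℤ)) * μ) :
    List.TFAE [
      -- (i) an orthogonal array attaining the bound
      ∃ t : ℕ, IsOrthogonalArray (A := BlockAlphabet p) (codeMultiset (nullCode H)) t ∧
        ((codeMultiset (nullCode H)).card : ℚ) =
          bierbrauerFriedmanBound (fun b : Block s n => BlockAlphabet p b) t,
      -- (i') an orthogonal array of the specified strength
      ∃ t : ℕ, (t : ℚ) = (μ + k) / (p : ℚ) ^ s - 1 ∧
        IsOrthogonalArray (A := BlockAlphabet p) (codeMultiset (nullCode H)) t,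
      -- (ii) a completely regular code
      (hammingMultigraph (fun b : Block s n => BlockAlphabet p b)).IsCRCode
        (nullCode H : Set (BlockSpace p s n)) k μ,
      -- (iii) the dual code is an alphabet-effective one-weight code
      IsAlphabetEffective (rowCode H) ∧
        IsOneWeight (rowCode H) (μ * (p : ℚ) ^ ((m : ℤ) - (s : ℤ))),
      -- (iv) a multifold partition
      IsFoldPartition (blockMultiset H) μ,
      -- (v) the dual multifold partition
      IsFoldPartition (dualBlockMultiset H) ν] := by
  classical
  have hp1 : (1 : ℚ) < p := one_lt_prime_cast
  have hp0 : (0 : ℚ) < p := zero_lt_one.trans hp1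
  have hs0 : (p : ℚ) ^ s ≠ 0 := pow_ne_zero _ hp0.ne'
  have hm0 : (p : ℚ) ^ m ≠ 0 := pow_ne_zero _ hp0.ne'
  have hm1 : (0 : ℚ) < (p : ℚ) ^ m - 1 := sub_pos.2 (one_lt_pow₀ hp1 (by omega))
  have hpow : ∀ b : Block s n, (p : ℚ) ^ b.size ≠ 0 := fun b => pow_ne_zero _ hp0.ne'
  have hz : (p : ℚ) ^ ((m : ℤ) - (s : ℤ)) = (p : ℚ) ^ m / (p : ℚ) ^ s := by
    rw [zpow_sub₀ hp0.ne', zpow_natCast, zpow_natCast]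
  rw [hz] at hν ⊢
  let b₀ : Block s n := ⟨⟨s, Finset.mem_Icc.2 ⟨hs, le_rfl⟩⟩, ⟨0, hn⟩⟩
  have hN0 : Fintype.card (Block s n) ≠ 0 := (Fintype.card_pos_iff.2 ⟨b₀⟩).ne'
  have hN : ∑ i ∈ Finset.Icc 1 s, (n i : ℚ) = Fintype.card (Block s n) := by
    simpa using (sum_block_size (s := s) (n := n) fun _ => 1).symm
  rw [hN] at hν
  have hμm : μ * ((p : ℚ) ^ m - 1) = k := by rw [hμ, div_mul_cancel₀ _ hm1.ne']
  have hk1 : k = ∑ b : Block s n, (p : ℚ) ^ (s - b.size) * ((p : ℚ) ^ b.size - 1) := by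
    rw [hk, ← sum_block_size fun i => (p : ℚ) ^ s - (p : ℚ) ^ (s - i)]
    refine Finset.sum_congr rfl fun b _ => ?_
    rw [prime_cast_pow_sub]
    field_simp [hpow b]
  have hk2 : k = (p : ℚ) ^ s * ∑ b : Block s n, (1 - 1 / (p : ℚ) ^ b.size) := by
    rw [hk1, Finset.mul_sum]
    refine Finset.sum_congr rfl fun b _ => ?_
    rw [prime_cast_pow_sub]
    field_simp [hpow b]
  have hk3 : k = ((∑ b : Block s n, p ^ (s - b.size) * (p ^ b.size - 1) : ℕ) : ℚ) := by
    rw [hk1, Nat.cast_sum]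
    refine Finset.sum_congr rfl fun b _ => ?_
    rw [Nat.cast_mul, Nat.cast_sub (Nat.one_le_pow _ _ (Fact.out : p.Prime).pos)]
    simp
  have hkpos : 0 < k := by
    rw [hk1]
    refine Finset.sum_pos (fun b _ => mul_pos (pow_pos hp0 _) (sub_pos.2 (one_lt_pow₀ hp1 ?_)))
      ⟨b₀, Finset.mem_univ _⟩
    have := (Finset.mem_Icc.1 b.1.2).1
    exact Nat.one_le_iff_ne_zero.1 this
  have hμpos : 0 < μ := by rw [hμ]; exact div_pos hkpos hm1
  -- As $k=\mu(p^m-1)$, the numerator is $\mu p^m$: the strength in (i') is one less than the weight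
  -- in (iii).
  have hw : (μ + k) / (p : ℚ) ^ s = μ * ((p : ℚ) ^ m / (p : ℚ) ^ s) := by
    rw [← hμm]
    field_simp
    ring
  have hνm : ν * ((p : ℚ) ^ m - 1) =
      ∑ b : Block s n, ((p : ℚ) ^ m / (p : ℚ) ^ b.size - 1) := by
    have : ∑ b : Block s n, ((p : ℚ) ^ m / (p : ℚ) ^ b.size - 1) =
        Fintype.card (Block s n) * ((p : ℚ) ^ m - 1) -
          (p : ℚ) ^ m * ∑ b : Block s n, (1 - 1 / (p : ℚ) ^ b.size) := by
      rw [Finset.mul_sum, ← nsmul_eq_mul, ← Finset.card_univ, ← Finset.sum_const,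
        ← Finset.sum_sub_distrib]
      exact Finset.sum_congr rfl fun b _ => by ring
    rw [this, hν, sub_mul]
    congr 1
    rw [div_mul_eq_mul_div, div_mul_eq_mul_div, div_eq_iff hs0, mul_assoc, hμm, hk2]
    ring
  have hsize := fun h => finrank_blockSpan_eq_size_of_sum_le (H := H) hνm h
  obtain ⟨u₀, hu₀⟩ : ∃ u : Fin m → ZMod p, u ≠ 0 :=
    ⟨fun _ => 1, fun h => one_ne_zero (congrFun h ⟨0, hm⟩)⟩
  rw [isFoldPartition_blockMultiset_iff, isFoldPartition_dualBlockMultiset_iff]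
  tfae_have 1 ↔ 2 := by
    refine exists_congr fun t => and_comm.trans (and_congr_left fun _ => ?_)
    rw [card_eq_bierbrauerFriedmanBound_iff hH hN0, eq_sub_iff_add_eq, hw, hμ]
    rw [hk2]
    rw [← eq_div_iff hm1.ne']
    refine Eq.congr_right ?_
    field_simp
  -- Weights are at least $t+1=n-\nu$, so each nonzero vector lies in at most $\nu$ duals; averaging
  -- forces equality.
  tfae_have 2 → 6 := by
    rintro ⟨t, ht, hOA⟩
    refine (hsize fun u hu => ?_).2
    have h1 := lt_blockWeight_of_isOrthogonalArray hH hOA hu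
    have h2 : (t : ℚ) + 1 ≤ blockWeight (rowWord H u) := by exact_mod_cast h1
    rw [blockWeight_rowWord, ht, hw] at h2
    rw [hν]
    linarith
  tfae_have 6 → 4 := by
    intro h
    refine ⟨isAlphabetEffective_rowCode (hsize fun u hu => (h u hu).le).1, fun c hc hc0 => ?_⟩
    obtain ⟨u, rfl⟩ := (mem_rowCode H).1 hc
    have hu : u ≠ 0 := by
      rintro rfl
      exact hc0 (funext fun b => Matrix.zero_vecMul _)
    rw [blockWeight_rowWord, h u hu, hν]
    ring
  tfae_have 4 → 2 := by
    rintro ⟨-, h⟩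
    have hweight : ∀ u ≠ 0, (blockWeight (rowWord H u) : ℚ) =
        μ * ((p : ℚ) ^ m / (p : ℚ) ^ s) :=
      fun u hu => h _ ((mem_rowCode H).2 ⟨u, rfl⟩) fun h0 => hu (eq_zero_of_rowWord_eq_zero hH h0)
    -- The common weight is positive, so subtracting one in `ℕ` to get the strength does not
    -- truncate.
    have hpos : 0 < blockWeight (rowWord H u₀) := by
      rw [← Nat.cast_pos (α := ℚ), hweight u₀ hu₀]
      positivity
    refine ⟨blockWeight (rowWord H u₀) - 1, ?_, isOrthogonalArray_nullCode hH ?_ fun u hu => ?_⟩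
    · rw [Nat.cast_sub hpos, hweight u₀ hu₀, hw, Nat.cast_one]
    · exact (Nat.sub_le _ _).trans (Finset.card_le_univ _)
    · have : blockWeight (rowWord H u) = blockWeight (rowWord H u₀) := by
        exact_mod_cast (hweight u hu).trans (hweight u₀ hu₀).symm
      omega
  tfae_have 6 → 5 := by
    intro h v hv
    have hfull := (hsize fun u hu => (h u hu).le).1
    have hdual := dual_weighted_partition (fun b => dotDual (blockSpan H b)) (fun _ => 1) ν h v hv
    simp only [dotDual_dotDual, natCard_dotDual_blockSpan (hfull _), one_mul] at hdual
    -- A dual of a full-rank block of size $i$ has $p^{m-i}$ elements. Up to the common factor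
    -- $p^{m-s}$ this is the multiplicity required in (iv).
    have : ∀ b : Block s n, (if v ∈ blockSpan H b then (p : ℚ) ^ (s - b.size) else 0) =
        (p : ℚ) ^ s / (p : ℚ) ^ m *
          (if v ∈ blockSpan H b then (p : ℚ) ^ m / (p : ℚ) ^ b.size else 0) := by
      intro b
      rw [prime_cast_pow_sub]
      split_ifs
      · field_simp
      · rw [mul_zero]
    rw [Finset.sum_congr rfl fun b _ => this b, ← Finset.mul_sum, hdual, hν]
    simp only [Finset.sum_const, Finset.card_univ, nsmul_eq_mul, mul_one]
    field_simp
    ring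
  tfae_have 5 → 6 := by
    intro h u hu
    have hfull := finrank_blockSpan_eq_size_of_isFoldPartition (hμm.trans hk1) h
    have hdual := dual_weighted_partition (blockSpan H) _ μ h u hu
    simp only [natCard_blockSpan (hfull _), prime_cast_pow_sub, div_mul_cancel₀ _ (hpow _)] at hdual
    -- The multiplicity $p^{s-i}$ times the block size $p^i$ is $p^s$ for every block, so the dual
    -- family is unweighted after dividing by $p^s$.
    have hone : ∀ b : Block s n, (if u ∈ dotDual (blockSpan H b) then (1 : ℚ) else 0) =
        ((p : ℚ) ^ s)⁻¹ * (if u ∈ dotDual (blockSpan H b) then (p : ℚ) ^ s else 0) := by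
      intro b
      split_ifs
      · rw [inv_mul_cancel₀ hs0]
      · rw [mul_zero]
    have hsum : ∑ b : Block s n, (p : ℚ) ^ s / (p : ℚ) ^ b.size =
        (p : ℚ) ^ s * Fintype.card (Block s n) - k := by
      rw [hk2, Finset.sum_sub_distrib, mul_sub, Finset.mul_sum, Finset.mul_sum]
      simp [div_eq_mul_inv, mul_comm]
    rw [Finset.sum_congr rfl fun b _ => hone b, ← Finset.mul_sum, hdual, hsum, hν, mul_comm _ μ,
      ← hw]
    field_simp
    ring
  tfae_have 3 → 5 := by
    rintro ⟨-, -, -, hin, hout⟩ v hv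
    have hinj := mulVec_injective_of_edgesTo_compl (H := H) hs hn (by
      have := hin 0 (zero_mem _)
      rw [hk3] at this
      exact_mod_cast this)
    -- Every nonzero vector is the syndrome of some non-codeword, so the edge count at that vertex
    -- gives the multiplicity of the vector.
    obtain ⟨x, rfl⟩ := syndrome_surjective hH v
    have hx : x ∉ nullCode H := fun hx => hv ((mem_nullCode H).1 hx)
    rw [← hout x hx, edgesTo_nullCode hs hn hinj hx]
    push_cast
    rfl
  tfae_have 5 → 3 := by
    intro h
    have hinj : ∀ b, Function.Injective (blockMatrix H b).mulVec := fun b =>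
      blockMatrix_mulVec_injective
        (finrank_blockSpan_eq_size_of_isFoldPartition (hμm.trans hk1) h b)
    refine ⟨isRegular_hammingMultigraph hs hn, hkpos, hμpos, fun x hx => ?_, fun x hx => ?_⟩
    · rw [edgesTo_compl_nullCode hs hn hinj hx, hk3]
    · rw [edgesTo_nullCode hs hn hinj hx,
        ← h (syndrome H x) fun h0 => hx ((mem_nullCode H).2 h0)]
      push_cast
      rfl
  tfae_finish
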